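/- Let $\mathcal H$ be a real Hilbert space and $n\ge 2$. Let $A_1,\dots,A_n:\mathcal H\rightrightarrows\mathcal H$ be maximally monotone, let $\beta>0$, and let $B_1,\dots,B_{n-1}:\mathcal H\to\mathcal H$ be $\beta$-cocoercive, i.e. $\langle B_i(x)-B_i(y),x-y\rangle\ge\beta\|B_i(x)-B_i(y)\|^2$ for all $x,y$. Write $\operatorname{zer}T=\{x:0\in T(x)\}$ and suppose that $\operatorname{zer}\big(\sum_{i=1}^nA_i+\sum_{i=1}^{n-1}B_i\big)\ne\varnothing$. Let $G=(\mathcal N,\mathcal E)$, $G'=(\mathcal N,\mathcal E')$, $G''=(\mathcal N,\mathcal E'')$ be directed graphs on $\mathcal N=\{1,\dots,n\}$ with $\mathcal E',\mathcal E''\subseteq\mathcal E$ such that: every $(i,j)\in\mathcal E$ satisfies $i<j$; $G$ and $G'$ are weakly connected; and in $G''$ every node $i\ge2$ has in-degree $1$. For a graph $F$ on $\mathcal N$ let $\operatorname{Adj}(F)$ be its adjacency matrix ($\operatorname{Adj}(F)_{ij}=1$ if $(i,j)$ is an edge of $F$, and $0$ otherwise), $\operatorname{Deg}(F)$ the diagonal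 matrix of total degrees (in-degree plus out-degree), $\operatorname{Inc}(F)$ its incidence matrix ($\operatorname{Inc}(F)_{ie}=1$ if the edge $e$ leaves $i$, $-1$ if $e$ enters $i$, and $0$ otherwise), and set $$\operatorname{Lap}(F)=\operatorname{Inc}(F)\operatorname{Inc}(F)^*,\quad P(F)=\operatorname{Deg}(F)-2\operatorname{Adj}(F)^*,\quad Q(F)=\operatorname{Adj}(F)-\operatorname{Adj}(F)^*.$$ Put $\overline{G'}=(\mathcal N,\mathcal E\setminus\mathcal E')$ and let $Z\in\mathbb R^{n\times(n-1)}$ be any matrix with $\operatorname{Lap}(G')=ZZ^*$. Let $\mathcal P=P(\overline{G'})\otimes\operatorname{Id}_{\mathcal H}$, $\mathcal Q=Q(G')\otimes\operatorname{Id}_{\mathcal H}$, $\mathcal R=P(G)\otimes\operatorname{Id}_{\mathcal H}$, $\mathcal Z=Z\otimes\operatorname{Id}_{\mathcal H}$, $\mathcal A_D=\operatorname{diag}(A_1,\dots,A_n)$ and $\mathcal B_D=\operatorname{diag}(0,B_1,\dots,B_{n-1})\,(\operatorname{Adj}(G'')^*\otimes\operatorname{Id}_{\mathcal H})$. For $\tau>0$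 define on the product Hilbert space $\mathcal H^{2n-1}=\mathcal H^n\times\mathcal H^{n-1}$ the operators $$\mathcal A=\begin{bmatrix}\tau\mathcal A_D+\mathcal P+\mathcal Q&-\mathcal Z\\ \mathcal Z^*&0\end{bmatrix},\qquad \mathcal B=\begin{bmatrix}\tau\mathcal B_D+\frac{\tau}{4\beta}\mathcal R&0\\0&0\end{bmatrix}.$$ Then, for every $\mathbf x=[x_1,\dots,x_n]\in\mathcal H^n$, $$\exists\,\mathbf v\in\mathcal H^{n-1}:\ [\mathbf x,\mathbf v]\in\operatorname{zer}(\mathcal A+\mathcal B)\iff x_1=\dots=x_n\in\operatorname{zer}\Big(\sum_{i=1}^nA_i+\sum_{i=1}^{n-1}B_i\Big).$$ Moreover, $\mathcal A+\mathcal B$ is maximally monotone. -/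

import Mathlib

open scoped Pointwise

noncomputable section

namespace GraphFB

/-! ### Set-valued operators

A set-valued operator on `E` is a map `E → Set E`. Sums of set-valued operators are the pointwise
Minkowski sums (the addition of `E → Set E` under `open scoped Pointwise`). -/

section Operators

variable {E : Type*}

/-- A single-valued operator, regarded as a set-valued one. -/
def ofFun (B : E → E) : E → Set E := fun x => {B x}

/-- The zeros of a set-valued operator. -/
def zer [Zero E] (A : E → Set E) : Set E := {x | 0 ∈ A x}

variable [NormedAddCommGroup E] [InnerProductSpace ℝ E]

/-- `⟨x - y, u - v⟩ ≥ 0` for all `(x, u)`, `(y, v)` in the graph of `A`. -/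
def IsMonotone (A : E → Set E) : Prop :=
  ∀ x y u v : E, u ∈ A x → v ∈ A y → 0 ≤ inner ℝ (x - y) (u - v)

/-- `A` is monotone and every monotone operator whose graph contains that of `A` equals `A`. -/
def IsMaximallyMonotone (A : E → Set E) : Prop :=
  IsMonotone A ∧ ∀ A' : E → Set E, IsMonotone A' → (∀ x, A x ⊆ A' x) → A = A'

/-- `β`-cocoercivity of a single-valued operator. -/
def IsCocoercive (β : ℝ) (B : E → E) : Prop :=
  ∀ x y : E, β * ‖B x - B y‖ ^ 2 ≤ inner ℝ (B x - B y) (x - y)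

end Operators

/-! ### Directed graphs on `Fin n` and their matrices -/

section Graphs

variable {n : ℕ}

/-- Weak connectedness: any two nodes are joined by a path that ignores the edge orientations. -/
def IsConnected (G : Digraph (Fin n)) : Prop := G.toSimpleGraphInclusive.Connected

/-- Algorithmic graph: at least two nodes, edges go from smaller to larger nodes, connected. -/
def IsAlgorithmic (G : Digraph (Fin n)) : Prop :=
  2 ≤ n ∧ (∀ i j, G.Adj i j → i < j) ∧ IsConnected G

/-- The number of edges that enter `i`. -/
def inDeg (G : Digraph (Fin n)) (i : Fin n) : ℕ := {j | G.Adj j i}.ncard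

/-- The number of edges that leave `i`. -/
def outDeg (G : Digraph (Fin n)) (i : Fin n) : ℕ := {j | G.Adj i j}.ncard

open Classical in
/-- The adjacency matrix of a directed graph. -/
def adj (G : Digraph (Fin n)) : Matrix (Fin n) (Fin n) ℝ :=
  Matrix.of fun i j => if G.Adj i j then 1 else 0

/-- The degree matrix: the diagonal matrix of total degrees. -/
def deg (G : Digraph (Fin n)) : Matrix (Fin n) (Fin n) ℝ :=
  Matrix.diagonal fun i => ((inDeg G i + outDeg G i : ℕ) : ℝ)

/-- The edges of a directed graph, as pairs (tail, head). -/
abbrev Edge (G : Digraph (Fin n)) : Type := {e : Fin n × Fin n // G.Adj e.1 e.2}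

instance (G : Digraph (Fin n)) : Fintype (Edge G) := Fintype.ofFinite _

/-- The incidence matrix (of an oriented graph): `1` if `e` leaves `i`, `-1` if `e` enters `i`. -/
def inc (G : Digraph (Fin n)) : Matrix (Fin n) (Edge G) ℝ :=
  Matrix.of fun i e => if e.1.1 = i then 1 else if e.1.2 = i then -1 else 0

/-- The Laplacian matrix (of an oriented graph). -/
def lap (G : Digraph (Fin n)) : Matrix (Fin n) (Fin n) ℝ := inc G * (inc G).transpose

/-- `P(G) = Deg(G) - 2 Adj(G)ᵀ`. -/
def matP (G : Digraph (Fin n)) : Matrix (Fin n) (Fin n) ℝ := deg G - (2 : ℝ) • (adj G).transpose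

/-- `Q(G) = Adj(G) - Adj(G)ᵀ`. -/
def matQ (G : Digraph (Fin n)) : Matrix (Fin n) (Fin n) ℝ := adj G - (adj G).transpose

end Graphs

/-! ### The lifted operators -/

section Lifted

/-- The product Hilbert space `Hᵏ`, with inner product `∑ i, ⟨x i, y i⟩`. -/
abbrev Pow (H : Type*) (k : ℕ) : Type _ := PiLp 2 (fun _ : Fin k => H)

/-- The product Hilbert space `Hⁿ × Hⁿ⁻¹ = H²ⁿ⁻¹`, with the sum of the inner products. -/
abbrev Lifted (H : Type*) (n : ℕ) : Type _ := WithLp 2 (Pow H n × Pow H (n - 1))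

variable {H : Type*} [NormedAddCommGroup H] [InnerProductSpace ℝ H] {n : ℕ}

/-- `M ⊗ Id` acting on a product space: the `i`-th entry is `∑ j, M i j • x j`. -/
def kron {k l : ℕ} (M : Matrix (Fin k) (Fin l) ℝ) (x : Pow H l) : Pow H k :=
  WithLp.toLp 2 fun i => ∑ j, M i j • x j

/-- `diag(A₁, …, Aₙ)`, as a set-valued operator on `Hⁿ`. -/
def diagA (A : Fin n → H → Set H) (x : Pow H n) : Set (Pow H n) := {a | ∀ i, a i ∈ A i (x i)}

/-- `diag(0, B₁, …, Bₙ₋₁)` on `Hⁿ`. With nodes counted from `0`, node `i ≥ 1` carries the operator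
with index `i - 1`. -/
def diagB (B : Fin (n - 1) → H → H) (x : Pow H n) : Pow H n :=
  WithLp.toLp 2 fun i => if h : i.val = 0 then 0 else B ⟨i.val - 1, by omega⟩ (x i)

/-- `B_D = diag(0, B₁, …, Bₙ₋₁) ∘ (Adj(G'')ᵀ ⊗ Id)`. -/
def opBD (G'' : Digraph (Fin n)) (B : Fin (n - 1) → H → H) (x : Pow H n) : Pow H n :=
  diagB B (kron (adj G'').transpose x)

/-- The lifted set-valued operator: at `[x, v]` it consists of all
`[τ a + (P(G \ G') ⊗ Id) x + (Q(G') ⊗ Id) x - (Z ⊗ Id) v, (Zᵀ ⊗ Id) x]` with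
`a ∈ A₁(x₁) × ⋯ × Aₙ(xₙ)`. -/
def liftA (τ : ℝ) (G G' : Digraph (Fin n)) (Z : Matrix (Fin n) (Fin (n - 1)) ℝ)
    (A : Fin n → H → Set H) (u : Lifted H n) : Set (Lifted H n) :=
  {w | ∃ a ∈ diagA A u.fst,
    w = WithLp.toLp 2
      (τ • a + kron (matP (G \ G')) u.fst + kron (matQ G') u.fst - kron Z u.snd,
        kron Z.transpose u.fst)}

/-- The lifted single-valued operator
`[x, v] ↦ [τ B_D(x) + (τ / (4 β)) (P(G) ⊗ Id) x, 0]`. -/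
def liftB (τ β : ℝ) (G G'' : Digraph (Fin n)) (B : Fin (n - 1) → H → H) (u : Lifted H n) :
    Lifted H n :=
  WithLp.toLp 2 (τ • opBD G'' B u.fst + (τ / (4 * β)) • kron (matP G) u.fst, 0)

end Lifted

end GraphFB

end

/-!
Moving `-Z` and `Zᵀ` aside, the first row of the lifted operator is `T = τ diag(A₁, …, Aₙ) + S` with
`S` single-valued and Lipschitz. The edges of `G''` lie in `G`, so the quadratic form
`∑ (i, j) ∈ G, ‖x i - x j‖²` of `P(G)` makes up for evaluating the cocoercive operators at the
neighbour's iterate, and `S` is monotone. Adding such an `S` preserves maximal monotonicity by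
Minty's theorem, which is obtained from the proximal point of the origin with respect to the
Fitzpatrick function. The skew coupling through `Z` then preserves it with no further surjectivity
argument: a pair monotonically related to the coupled graph already splits into its two rows.

For the zeros, `Lap(G') = Z Zᵀ` makes the kernel of `Zᵀ` the constant vectors, since `G'` is
connected, and hence the range of `Z` the vectors with zero sum. So a zero is a consensus vector at
which some element of `T` sums to zero, and since the entries of each `P` and `Q` sum to zero, only
the `Aᵢ` and `Bᵢ` contribute to this sum.
-/

noncomputable section

namespace GraphFB

open scoped InnerProductSpace

section Operators

theorem mem_add_ofFun {E : Type*} [AddCommGroup E] {A : E → Set E} {C : E → E} {x u : E} :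
    u ∈ (A + ofFun C) x ↔ u - C x ∈ A x := by
  simp only [Pi.add_apply, ofFun, Set.add_singleton, Set.mem_image, ← eq_sub_iff_add_eq,
    exists_eq_right]

theorem mem_zer_sum_add_sum_ofFun {E ι κ : Type*} [AddCommGroup E] [Fintype ι] [Fintype κ]
    {A : ι → E → Set E} {B : κ → E → E} {z : E} :
    z ∈ zer (∑ i, A i + ∑ k, ofFun (B k)) ↔
      ∃ a : ι → E, (∀ i, a i ∈ A i z) ∧ ∑ i, a i + ∑ k, B k z = 0 := by
  have hB : ∑ k, ofFun (B k) = ofFun fun x => ∑ k, B k x := by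
    ext1 x
    rw [Finset.sum_apply]
    exact Set.finsetSum_singleton _ _
  rw [zer, Set.mem_ofPred_eq, hB, mem_add_ofFun, Finset.sum_apply, Set.mem_fintype_sum, zero_sub]
  simp only [eq_neg_iff_add_eq_zero, exists_prop]

variable {E : Type*} [NormedAddCommGroup E] [InnerProductSpace ℝ E] {A : E → Set E}

theorem IsMonotone.isMaximallyMonotone (hA : IsMonotone A)
    (hmem : ∀ x u, (∀ y, ∀ v ∈ A y, 0 ≤ ⟪x - y, u - v⟫_ℝ) → u ∈ A x) :
    IsMaximallyMonotone A :=
  ⟨hA, fun _ hA' hsub => funext fun x => (hsub x).antisymm fun u hu =>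
    hmem x u fun y v hv => hA' x y u v hu (hsub y hv)⟩

theorem IsMaximallyMonotone.mem_of_forall_inner_nonneg (hA : IsMaximallyMonotone A) {x u : E}
    (h : ∀ y, ∀ v ∈ A y, 0 ≤ ⟪x - y, u - v⟫_ℝ) : u ∈ A x := by
  rw [hA.2 (fun z => A z ∪ {w | z = x ∧ w = u}) ?_ fun z => Set.subset_union_left]
  · exact Or.inr ⟨rfl, rfl⟩
  · rintro y z v w (hv | ⟨rfl, rfl⟩) (hw | ⟨rfl, rfl⟩)
    · exact hA.1 y z v w hv hw
    · rw [← neg_sub z, ← neg_sub w, inner_neg_neg]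
      exact h y v hv
    · exact h z w hw
    · rw [sub_self, inner_zero_left]

theorem IsMaximallyMonotone.exists_mem_inner_nonpos (hA : IsMaximallyMonotone A) (x u : E) :
    ∃ y, ∃ v ∈ A y, ⟪x - y, u - v⟫_ℝ ≤ 0 := by
  by_contra! hpos
  have hu : u ∈ A x := hA.mem_of_forall_inner_nonneg fun y v hv => (hpos y v hv).le
  simpa using hpos x u hu

theorem mem_smul_iff {c : ℝ} (hc : c ≠ 0) {x u : E} : u ∈ (c • A) x ↔ c⁻¹ • u ∈ A x :=
  Set.mem_smul_set_iff_inv_smul_mem₀ hc _ _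

theorem IsMaximallyMonotone.smul (hA : IsMaximallyMonotone A) {c : ℝ} (hc : 0 < c) :
    IsMaximallyMonotone (c • A) := by
  have hinner (x y u v : E) : ⟪x - y, c⁻¹ • u - v⟫_ℝ = c⁻¹ * ⟪x - y, u - c • v⟫_ℝ := by
    rw [← inner_smul_right, smul_sub, inv_smul_smul₀ hc.ne']
  refine IsMonotone.isMaximallyMonotone (fun x y u v hu hv => ?_) fun x u h => ?_
  · rw [mem_smul_iff hc.ne'] at hu hv
    have := hA.1 x y _ _ hu hv
    rwa [hinner, smul_inv_smul₀ hc.ne', mul_nonneg_iff_of_pos_left (inv_pos.2 hc)] at this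
  · rw [mem_smul_iff hc.ne']
    refine hA.mem_of_forall_inner_nonneg fun y v hv => ?_
    rw [hinner]
    exact mul_nonneg (inv_nonneg.2 hc.le) (h y _ (Set.smul_mem_smul_set hv))

theorem IsMaximallyMonotone.add_const (hA : IsMaximallyMonotone A) (c : E) :
    IsMaximallyMonotone (A + ofFun fun _ => c) := by
  refine IsMonotone.isMaximallyMonotone (fun x y u v hu hv => ?_) fun x u h => ?_
  · simpa using hA.1 x y _ _ (mem_add_ofFun.1 hu) (mem_add_ofFun.1 hv)
  · refine mem_add_ofFun.2 (hA.mem_of_forall_inner_nonneg fun y v hv => ?_)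
    have := h y (v + c) (mem_add_ofFun.2 (by simpa using hv))
    rwa [← sub_sub, sub_right_comm] at this

end Operators

/-! ### Minty's theorem -/

section ProximalPoint

variable {F : Type*} [NormedAddCommGroup F] [InnerProductSpace ℝ F]

/-- The objective `t + ‖z‖² / 2`, whose minimiser over the epigraph of a convex function is the
proximal point of the origin. -/
def proxCost (p : F × ℝ) : ℝ := p.2 + ‖p.1‖ ^ 2 / 2

theorem proxCost_convexCombination (p q : F × ℝ) (s : ℝ) :
    proxCost ((1 - s) • p + s • q) =
      (1 - s) * proxCost p + s * proxCost q - s * (1 - s) * ‖p.1 - q.1‖ ^ 2 / 2 := by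
  simp only [proxCost, Prod.smul_fst, Prod.smul_snd, Prod.fst_add, Prod.snd_add, smul_eq_mul,
    norm_add_sq_real, norm_sub_sq_real, norm_smul, inner_smul_left, inner_smul_right, mul_pow,
    Real.norm_eq_abs, sq_abs, conj_trivial]
  ring

variable {C : Set (F × ℝ)}

theorem sq_norm_sub_le_of_proxCost_le (hconv : Convex ℝ C) {m c : ℝ}
    (hm : ∀ p ∈ C, m ≤ proxCost p) {p q : F × ℝ} (hp : p ∈ C) (hq : q ∈ C)
    (hpc : proxCost p ≤ c) (hqc : proxCost q ≤ c) : ‖p.1 - q.1‖ ^ 2 ≤ 8 * (c - m) := by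
  have hmid := hm _ (hconv hp hq (a := 1 - 1 / 2) (b := 1 / 2) (by norm_num) (by norm_num)
    (by norm_num))
  rw [proxCost_convexCombination] at hmid
  linarith

theorem exists_isMinOn_proxCost [CompleteSpace F] (hne : C.Nonempty) (hconv : Convex ℝ C)
    (hclosed : IsClosed C) (hbdd : BddBelow (proxCost '' C)) : ∃ p ∈ C, IsMinOn proxCost C p := by
  obtain ⟨c, hc_anti, hc_lim, hc_mem⟩ := exists_seq_tendsto_sInf (hne.image proxCost) hbdd
  set m := sInf (proxCost '' C)
  have hm (q) (hq : q ∈ C) : m ≤ proxCost q := csInf_le hbdd (Set.mem_image_of_mem _ hq)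
  choose p hpC hpc using hc_mem
  have hcauchy : CauchySeq fun k => (p k).1 := by
    refine cauchySeq_of_le_tendsto_0 (fun N => √(8 * (c N - m))) (fun k l N hk hl => ?_) ?_
    · rw [dist_eq_norm]
      exact Real.le_sqrt_of_sq_le (sq_norm_sub_le_of_proxCost_le hconv hm (hpC k) (hpC l)
        ((hpc k).trans_le (hc_anti hk)) ((hpc l).trans_le (hc_anti hl)))
    · simpa using ((hc_lim.sub_const m).const_mul 8).sqrt
  obtain ⟨z, hz⟩ := cauchySeq_tendsto_of_complete hcauchy
  have ht : Filter.Tendsto (fun k => (p k).2) Filter.atTop (nhds (m - ‖z‖ ^ 2 / 2)) :=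
    (hc_lim.sub ((hz.norm.pow 2).div_const 2)).congr fun k => by rw [← hpc, proxCost]; ring
  refine ⟨(z, m - ‖z‖ ^ 2 / 2),
    hclosed.mem_of_tendsto (hz.prodMk_nhds ht) (.of_forall hpC), fun q hq => ?_⟩
  simpa [proxCost] using hm q hq

theorem sq_norm_add_le_inner_add_of_isMinOn (hconv : Convex ℝ C) {p q : F × ℝ} (hp : p ∈ C)
    (hmin : IsMinOn proxCost C p) (hq : q ∈ C) : ‖p.1‖ ^ 2 + p.2 ≤ ⟪p.1, q.1⟫_ℝ + q.2 := by
  have hseg : ∀ s ∈ Set.Ioc (0 : ℝ) 1,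
      proxCost p + (1 - s) * ‖p.1 - q.1‖ ^ 2 / 2 ≤ proxCost q := by
    intro s ⟨hs0, hs1⟩
    have hle : proxCost p ≤ _ := hmin (hconv hp hq (sub_nonneg.2 hs1) hs0.le (by ring))
    rw [proxCost_convexCombination] at hle
    refine le_of_mul_le_mul_left ?_ hs0
    linarith
  have hlim : Filter.Tendsto (fun s : ℝ => proxCost p + (1 - s) * ‖p.1 - q.1‖ ^ 2 / 2)
      (nhdsWithin 0 (Set.Ioi 0)) (nhds (proxCost p + (1 - 0) * ‖p.1 - q.1‖ ^ 2 / 2)) :=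
    (Continuous.tendsto (by fun_prop) 0).mono_left nhdsWithin_le_nhds
  have h0 := le_of_tendsto hlim (Filter.mem_of_superset (Ioc_mem_nhdsGT zero_lt_one) hseg)
  simp only [proxCost, norm_sub_sq_real] at h0
  linarith

end ProximalPoint

section Minty

variable {E : Type*} [NormedAddCommGroup E] [InnerProductSpace ℝ E] {A : E → Set E}

/-- The epigraph of the Fitzpatrick function `(x, u) ↦ sup {⟪x, v⟫ + ⟪y, u⟫ - ⟪y, v⟫ | v ∈ A y}`
of `A`, which majorises `⟪x, u⟫` when `A` is maximally monotone. -/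
def fitzpatrickEpigraph (A : E → Set E) : Set (WithLp 2 (E × E) × ℝ) :=
  {p | ∀ y, ∀ v ∈ A y, ⟪p.1, WithLp.toLp 2 (v, y)⟫_ℝ - ⟪y, v⟫_ℝ ≤ p.2}

theorem convex_fitzpatrickEpigraph (A : E → Set E) : Convex ℝ (fitzpatrickEpigraph A) := by
  intro p hp q hq a b ha hb hab y v hv
  simp only [Prod.fst_add, Prod.snd_add, Prod.smul_fst, Prod.smul_snd, inner_add_left,
    real_inner_smul_left, smul_eq_mul]
  linear_combination a * hp y v hv + b * hq y v hv + ⟪y, v⟫_ℝ * hab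

theorem isClosed_fitzpatrickEpigraph (A : E → Set E) : IsClosed (fitzpatrickEpigraph A) := by
  simp only [fitzpatrickEpigraph, Set.ofPred_forall]
  exact isClosed_iInter fun y => isClosed_iInter fun v => isClosed_iInter fun _ =>
    isClosed_le (by fun_prop) (by fun_prop)

theorem IsMonotone.mem_fitzpatrickEpigraph (hA : IsMonotone A) {x u : E} (hu : u ∈ A x) :
    (WithLp.toLp 2 (x, u), ⟪x, u⟫_ℝ) ∈ fitzpatrickEpigraph A := by
  intro y v hv
  have := hA x y u v hu hv
  simp only [WithLp.prod_inner_apply, inner_sub_left, inner_sub_right] at this ⊢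
  linarith [real_inner_comm u y]

theorem IsMaximallyMonotone.inner_le_of_mem_fitzpatrickEpigraph (hA : IsMaximallyMonotone A)
    {p : WithLp 2 (E × E) × ℝ} (hp : p ∈ fitzpatrickEpigraph A) :
    ⟪p.1.fst, p.1.snd⟫_ℝ ≤ p.2 := by
  obtain ⟨y, v, hv, hle⟩ := hA.exists_mem_inner_nonpos p.1.fst p.1.snd
  have := hp y v hv
  simp only [WithLp.prod_inner_apply, WithLp.ofLp_fst, WithLp.ofLp_snd, inner_sub_left,
    inner_sub_right] at this hle
  linarith [real_inner_comm p.1.snd y]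

theorem IsMaximallyMonotone.exists_neg_mem [CompleteSpace E] (hA : IsMaximallyMonotone A) :
    ∃ x, -x ∈ A x := by
  have hconv := convex_fitzpatrickEpigraph A
  obtain ⟨y₀, v₀, hv₀, -⟩ := hA.exists_mem_inner_nonpos 0 0
  have hbdd : BddBelow (proxCost '' fitzpatrickEpigraph A) := by
    refine ⟨0, Set.forall_mem_image.2 fun p hp => ?_⟩
    have := hA.inner_le_of_mem_fitzpatrickEpigraph hp
    rw [proxCost, WithLp.prod_norm_sq_eq_of_L2]
    linarith [sq_nonneg ‖p.1.fst + p.1.snd‖, norm_add_sq_real p.1.fst p.1.snd]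
  obtain ⟨p, hp, hmin⟩ := exists_isMinOn_proxCost ⟨_, hA.1.mem_fitzpatrickEpigraph hv₀⟩ hconv
    (isClosed_fitzpatrickEpigraph A) hbdd
  set x := p.1.fst
  set u := p.1.snd
  have hsq : ∀ y, ∀ v ∈ A y, ‖x + u‖ ^ 2 ≤ ⟪-u - y, -x - v⟫_ℝ := by
    intro y v hv
    have hopt := sq_norm_add_le_inner_add_of_isMinOn hconv hp hmin
      (hA.1.mem_fitzpatrickEpigraph hv)
    have hxu : ⟪x, u⟫_ℝ ≤ p.2 := hA.inner_le_of_mem_fitzpatrickEpigraph hp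
    simp only [WithLp.prod_norm_sq_eq_of_L2, WithLp.prod_inner_apply, WithLp.ofLp_fst,
      WithLp.ofLp_snd] at hopt
    simp only [norm_add_sq_real, inner_sub_left, inner_sub_right, inner_neg_left, inner_neg_right]
    linarith [real_inner_comm x u, real_inner_comm x y]
  have hmem : -x ∈ A (-u) :=
    hA.mem_of_forall_inner_nonneg fun y v hv => (sq_nonneg _).trans (hsq y v hv)
  have hxu : x + u = 0 := by simpa using hsq _ _ hmem
  exact ⟨x, by rwa [← eq_neg_of_add_eq_zero_left hxu] at hmem⟩

theorem IsMaximallyMonotone.exists_sub_smul_mem [CompleteSpace E] (hA : IsMaximallyMonotone A)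
    {μ : ℝ} (hμ : 0 < μ) (z : E) : ∃ x, z - μ • x ∈ A x := by
  obtain ⟨x, hx⟩ := ((hA.add_const (-z)).smul (inv_pos.2 hμ)).exists_neg_mem
  rw [mem_smul_iff (inv_ne_zero hμ.ne'), mem_add_ofFun, inv_inv, smul_neg] at hx
  exact ⟨x, by rwa [sub_neg_eq_add, neg_add_eq_sub] at hx⟩

theorem IsMaximallyMonotone.add_ofFun [CompleteSpace E] (hA : IsMaximallyMonotone A) {C : E → E}
    (hC : ∀ x y, 0 ≤ ⟪x - y, C x - C y⟫_ℝ) {K : NNReal} (hK : LipschitzWith K C) :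
    IsMaximallyMonotone (A + ofFun C) := by
  refine IsMonotone.isMaximallyMonotone (fun x y u v hu hv => ?_) fun x u h => ?_
  · have := add_nonneg (hA.1 x y _ _ (mem_add_ofFun.1 hu) (mem_add_ofFun.1 hv)) (hC x y)
    rwa [← inner_add_right, ← sub_sub_sub_comm, sub_add_cancel] at this
  · obtain ⟨y, hy⟩ := hA.exists_sub_smul_mem (μ := K + 1) (by positivity)
      (u - C x + (K + 1 : ℝ) • x)
    have hrel := h y (u - C x + (K + 1 : ℝ) • x - (K + 1 : ℝ) • y + C y)
      (mem_add_ofFun.2 (by simpa using hy))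
    have hdiff : u - (u - C x + (K + 1 : ℝ) • x - (K + 1 : ℝ) • y + C y) =
        C x - C y - (K + 1 : ℝ) • (x - y) := by
      module
    rw [hdiff, inner_sub_right, real_inner_smul_right, real_inner_self_eq_norm_sq] at hrel
    have hlip : ⟪x - y, C x - C y⟫_ℝ ≤ K * ‖x - y‖ ^ 2 := by
      have := mul_le_mul_of_nonneg_left (hK.norm_sub_le x y) (norm_nonneg (x - y))
      linarith [real_inner_le_norm (x - y) (C x - C y)]
    have hxy : x = y := by
      rw [← sub_eq_zero, ← norm_eq_zero, ← sq_eq_zero_iff]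
      exact le_antisymm (by linarith) (sq_nonneg _)
    subst hxy
    exact mem_add_ofFun.2 (by simpa using hy)

end Minty

/-! ### Block operators on product spaces -/

section Saddle

variable {X V : Type*} [NormedAddCommGroup X] [NormedAddCommGroup V] {T : X → Set X}
  {L' : X → V} {L : V → X}

/-- The block operator `[[T, -L], [L', 0]]` of a saddle-point problem: at `[x, v]` it consists of
all `[t - L v, L' x]` with `t ∈ T x`. It is used with `L'` adjoint to `L`. -/
def saddle (T : X → Set X) (L : V → X) (L' : X → V) (u : WithLp 2 (X × V)) :
    Set (WithLp 2 (X × V)) :=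
  {w | w.fst + L u.snd ∈ T u.fst ∧ w.snd = L' u.fst}

theorem zero_mem_saddle_iff {x : X} {v : V} :
    0 ∈ saddle T L L' (WithLp.toLp 2 (x, v)) ↔ L v ∈ T x ∧ L' x = 0 := by
  simp [saddle, eq_comm]

variable [InnerProductSpace ℝ X] [InnerProductSpace ℝ V]

theorem inner_sub_sub_eq_of_adjoint (hadj : ∀ x v, ⟪x, L v⟫_ℝ = ⟪v, L' x⟫_ℝ)
    (u u' w w' : WithLp 2 (X × V)) (hw' : w'.snd = L' u'.fst) :
    ⟪u - u', w - w'⟫_ℝ =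
      ⟪u.fst - u'.fst, w.fst + L u.snd - (w'.fst + L u'.snd)⟫_ℝ +
        ⟪u.snd - u'.snd, w.snd - L' u.fst⟫_ℝ := by
  simp only [WithLp.prod_inner_apply, WithLp.ofLp_fst, WithLp.ofLp_snd, hw', inner_sub_left,
    inner_sub_right, inner_add_right]
  linear_combination hadj u.fst u'.snd - hadj u.fst u.snd + hadj u'.fst u.snd - hadj u'.fst u'.snd

theorem IsMaximallyMonotone.saddle (hT : IsMaximallyMonotone T)
    (hadj : ∀ x v, ⟪x, L v⟫_ℝ = ⟪v, L' x⟫_ℝ) : IsMaximallyMonotone (saddle T L L') := by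
  refine IsMonotone.isMaximallyMonotone (fun u u' w w' hw hw' => ?_) fun u w h => ?_
  · rw [inner_sub_sub_eq_of_adjoint hadj _ _ _ _ hw'.2, hw.2, sub_self, inner_zero_right, add_zero]
    exact hT.1 _ _ _ _ hw.1 hw'.1
  · have hrel (y t) (ht : t ∈ T y) (q) :
        0 ≤ ⟪u.fst - y, w.fst + L u.snd - t⟫_ℝ + ⟪u.snd - q, w.snd - L' u.fst⟫_ℝ := by
      have := h (WithLp.toLp 2 (y, q)) (WithLp.toLp 2 (t - L q, L' y)) ⟨by simpa using ht, rfl⟩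
      rw [inner_sub_sub_eq_of_adjoint hadj _ _ _ _ rfl] at this
      simpa using this
    have hw₂ : w.snd = L' u.fst := by
      obtain ⟨y, t, ht, hle⟩ := hT.exists_mem_inner_nonpos u.fst (w.fst + L u.snd)
      have := hrel y t ht (u.snd + (w.snd - L' u.fst))
      rw [sub_add_cancel_left, inner_neg_left] at this
      exact sub_eq_zero.1 (real_inner_self_nonpos.1 (by linarith))
    refine ⟨hT.mem_of_forall_inner_nonneg fun y t ht => ?_, hw₂⟩
    simpa [hw₂] using hrel y t ht 0

end Saddle

section Pow

variable {H : Type*} [NormedAddCommGroup H] [InnerProductSpace ℝ H] {k l m : ℕ}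

theorem isMaximallyMonotone_diagA {A : Fin k → H → Set H} (hA : ∀ i, IsMaximallyMonotone (A i)) :
    IsMaximallyMonotone (diagA A) := by
  refine IsMonotone.isMaximallyMonotone (fun x y u v hu hv => ?_) fun x u h i => ?_
  · rw [PiLp.inner_apply]
    exact Finset.sum_nonneg fun i _ => (hA i).1 _ _ _ _ (hu i) (hv i)
  · refine (hA i).mem_of_forall_inner_nonneg fun y v hv => ?_
    by_contra! hneg
    choose p q hq hpq using fun j => (hA j).exists_mem_inner_nonpos (x j) (u j)
    have hmem : WithLp.toLp 2 (Function.update q i v) ∈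
        diagA A (WithLp.toLp 2 (Function.update p i y)) := by
      intro j
      obtain rfl | hj := eq_or_ne j i
      · simpa using hv
      · simpa [hj] using hq j
    refine (h _ _ hmem).not_gt ?_
    rw [PiLp.inner_apply]
    refine Finset.sum_neg' (fun j _ => ?_) ⟨i, Finset.mem_univ i, by simpa using hneg⟩
    obtain rfl | hj := eq_or_ne j i
    · simpa using hneg.le
    · simpa [hj] using hpq j

/-- `M ⊗ Id` as a continuous linear map. -/
def kronCLM (M : Matrix (Fin k) (Fin l) ℝ) : Pow H l →L[ℝ] Pow H k where
  toFun := kron M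
  map_add' x y := by
    ext i
    simp [kron, Finset.sum_add_distrib]
  map_smul' c x := by
    ext i
    simp [kron, Finset.smul_sum, smul_comm c]
  cont := by
    unfold kron
    fun_prop

theorem exists_lipschitzWith_kron (M : Matrix (Fin k) (Fin l) ℝ) :
    ∃ K, LipschitzWith K (kron M : Pow H l → Pow H k) :=
  ⟨_, (kronCLM (H := H) M).lipschitz⟩

theorem kron_sub (M : Matrix (Fin k) (Fin l) ℝ) (x y : Pow H l) :
    kron M (x - y) = kron M x - kron M y :=
  (kronCLM M).map_sub x y

theorem kron_apply (M : Matrix (Fin k) (Fin l) ℝ) (x : Pow H l) (i : Fin k) :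
    kron M x i = ∑ j, M i j • x j := rfl

theorem kron_mul (M : Matrix (Fin k) (Fin l) ℝ) (N : Matrix (Fin l) (Fin m) ℝ) (x : Pow H m) :
    kron (M * N) x = kron M (kron N x) := by
  ext i
  simp only [kron_apply, Matrix.mul_apply, Finset.sum_smul, Finset.smul_sum, smul_smul]
  exact Finset.sum_comm

theorem inner_kron (M : Matrix (Fin k) (Fin l) ℝ) (x : Pow H k) (y : Pow H l) :
    ⟪x, kron M y⟫_ℝ = ∑ i, ∑ j, M i j * ⟪x i, y j⟫_ℝ := by
  simp only [PiLp.inner_apply, kron_apply, inner_sum, inner_smul_right]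

theorem inner_kron_transpose (M : Matrix (Fin k) (Fin l) ℝ) (x : Pow H k) (y : Pow H l) :
    ⟪y, kron M.transpose x⟫_ℝ = ⟪x, kron M y⟫_ℝ := by
  rw [inner_kron, inner_kron, Finset.sum_comm]
  simp only [Matrix.transpose_apply, real_inner_comm]

theorem sum_kron_const (M : Matrix (Fin k) (Fin l) ℝ) {x : Pow H l} {z : H} (hx : ∀ i, x i = z) :
    ∑ i, kron M x i = (∑ i, ∑ j, M i j) • z := by
  simp only [kron_apply, hx, Finset.sum_smul]

theorem sum_kron (M : Matrix (Fin k) (Fin l) ℝ) (x : Pow H l) :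
    ∑ i, kron M x i = ∑ j, M.transpose.mulVec 1 j • x j := by
  simp only [kron_apply, Matrix.mulVec, dotProduct, Matrix.transpose_apply, Pi.one_apply, mul_one,
    Finset.sum_smul]
  exact Finset.sum_comm

theorem kron_eq_zero_iff (M : Matrix (Fin k) (Fin l) ℝ) (x : Pow H l) :
    kron M x = 0 ↔ ∀ y, M.mulVec (fun i => ⟪y, x i⟫_ℝ) = 0 := by
  have h (i y) : ⟪y, kron M x i⟫_ℝ = M.mulVec (fun i => ⟪y, x i⟫_ℝ) i := by
    simp only [kron_apply, inner_sum, inner_smul_right, Matrix.mulVec, dotProduct]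
  simp only [PiLp.ext_iff, funext_iff, ← h, PiLp.zero_apply, Pi.zero_apply]
  exact ⟨fun h0 y i => by rw [h0, inner_zero_right],
    fun h0 i => inner_self_eq_zero.1 (h0 _ i)⟩

end Pow

/-! ### Matrices of directed graphs -/

section GraphMatrices

variable {n : ℕ} {F : Digraph (Fin n)}

theorem adj_nonneg (F : Digraph (Fin n)) (i j : Fin n) : 0 ≤ adj F i j := by
  rw [adj, Matrix.of_apply]
  positivity

theorem adj_eq_one {i j : Fin n} (h : F.Adj i j) : adj F i j = 1 := by
  rw [adj, Matrix.of_apply, if_pos h]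

theorem inDeg_eq_sum (F : Digraph (Fin n)) (i : Fin n) : (inDeg F i : ℝ) = ∑ j, adj F j i := by
  classical
  simp [inDeg, adj, Set.ncard_eq_toFinset_card']

theorem outDeg_eq_sum (F : Digraph (Fin n)) (i : Fin n) : (outDeg F i : ℝ) = ∑ j, adj F i j := by
  classical
  simp [outDeg, adj, Set.ncard_eq_toFinset_card']

variable {H : Type*} [NormedAddCommGroup H] [InnerProductSpace ℝ H]

theorem inner_kron_deg (F : Digraph (Fin n)) (x : Pow H n) :
    ⟪x, kron (deg F) x⟫_ℝ = ∑ i, ∑ j, adj F i j * (‖x i‖ ^ 2 + ‖x j‖ ^ 2) := by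
  have hin : ∑ i, ∑ j, adj F i j * ‖x j‖ ^ 2 = ∑ i, inDeg F i * ‖x i‖ ^ 2 := by
    rw [Finset.sum_comm]
    simp only [inDeg_eq_sum, Finset.sum_mul]
  have hout : ∑ i, ∑ j, adj F i j * ‖x i‖ ^ 2 = ∑ i, outDeg F i * ‖x i‖ ^ 2 := by
    simp only [outDeg_eq_sum, Finset.sum_mul]
  simp only [mul_add, Finset.sum_add_distrib, hin, hout]
  simp only [inner_kron, deg, Matrix.diagonal_apply, ite_mul, zero_mul, Finset.sum_ite_eq,
    Finset.mem_univ, if_true, real_inner_self_eq_norm_sq, Nat.cast_add, add_mul,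
    Finset.sum_add_distrib]
  exact add_comm _ _

theorem inner_kron_matP (F : Digraph (Fin n)) (x : Pow H n) :
    ⟪x, kron (matP F) x⟫_ℝ = ∑ i, ∑ j, adj F i j * ‖x i - x j‖ ^ 2 := by
  calc
    _ = ⟪x, kron (deg F) x⟫_ℝ - 2 * ⟪x, kron (adj F).transpose x⟫_ℝ := by
      simp only [inner_kron, matP, Matrix.sub_apply, Matrix.smul_apply, smul_eq_mul, sub_mul,
        mul_assoc, Finset.sum_sub_distrib, Finset.mul_sum]
    _ = _ := by
      rw [inner_kron_deg, inner_kron_transpose, inner_kron, Finset.mul_sum,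
        ← Finset.sum_sub_distrib]
      refine Finset.sum_congr rfl fun i _ => ?_
      rw [Finset.mul_sum, ← Finset.sum_sub_distrib]
      refine Finset.sum_congr rfl fun j _ => ?_
      rw [norm_sub_sq_real]
      ring

theorem inner_kron_matP_nonneg (F : Digraph (Fin n)) (x : Pow H n) :
    0 ≤ ⟪x, kron (matP F) x⟫_ℝ := by
  rw [inner_kron_matP]
  exact Finset.sum_nonneg fun i _ => Finset.sum_nonneg fun j _ =>
    mul_nonneg (adj_nonneg F i j) (sq_nonneg _)

theorem inner_kron_matQ (F : Digraph (Fin n)) (x : Pow H n) : ⟪x, kron (matQ F) x⟫_ℝ = 0 := by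
  calc
    _ = ⟪x, kron (adj F) x⟫_ℝ - ⟪x, kron (adj F).transpose x⟫_ℝ := by
      simp only [inner_kron, matQ, Matrix.sub_apply, sub_mul, Finset.sum_sub_distrib]
    _ = 0 := by rw [inner_kron_transpose, sub_self]

theorem sum_sum_matP (F : Digraph (Fin n)) : ∑ i, ∑ j, matP F i j = 0 := by
  simpa [inner_kron] using inner_kron_matP F (WithLp.toLp 2 fun _ => (1 : ℝ))

theorem sum_sum_matQ (F : Digraph (Fin n)) : ∑ i, ∑ j, matQ F i j = 0 := by
  simpa [inner_kron] using inner_kron_matQ F (WithLp.toLp 2 fun _ => (1 : ℝ))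

theorem inc_transpose_mulVec (hloop : ∀ i, ¬F.Adj i i) (a : Fin n → ℝ) (e : Edge F) :
    (inc F).transpose.mulVec a e = a e.1.1 - a e.1.2 := by
  have hentry (i) : inc F i e = (if e.1.1 = i then 1 else 0) - if e.1.2 = i then 1 else 0 := by
    rw [inc, Matrix.of_apply]
    split_ifs with h₁ h₂
    · exact absurd e.2 (h₂ ▸ h₁ ▸ hloop i)
    all_goals norm_num
  simp [Matrix.mulVec, dotProduct, hentry, sub_mul, Finset.sum_sub_distrib]

theorem apply_eq_of_isConnected (hF : IsConnected F) {X : Type*} {a : Fin n → X}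
    (ha : ∀ i j, F.Adj i j → a i = a j) (i j : Fin n) : a i = a j := by
  obtain ⟨p⟩ := hF.preconnected i j
  induction p with
  | nil => rfl
  | cons h _ ih => exact (h.2.elim (ha _ _) fun h' => (ha _ _ h').symm).trans ih

variable {k : ℕ} {Z : Matrix (Fin n) (Fin k) ℝ}

theorem transpose_mulVec_eq_zero_iff_inc (hZ : lap F = Z * Z.transpose) (a : Fin n → ℝ) :
    Z.transpose.mulVec a = 0 ↔ (inc F).transpose.mulVec a = 0 := by
  simp only [← Matrix.conjTranspose_eq_transpose_of_trivial,
    ← Matrix.self_mul_conjTranspose_mulVec_eq_zero]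
  simp only [Matrix.conjTranspose_eq_transpose_of_trivial, ← hZ, lap]

theorem transpose_mulVec_eq_zero_iff (hloop : ∀ i, ¬F.Adj i i) (hconn : IsConnected F)
    (hZ : lap F = Z * Z.transpose) (a : Fin n → ℝ) :
    Z.transpose.mulVec a = 0 ↔ ∀ i j, a i = a j := by
  simp only [transpose_mulVec_eq_zero_iff_inc hZ, funext_iff, inc_transpose_mulVec hloop,
    Pi.zero_apply, sub_eq_zero, Subtype.forall, Prod.forall]
  exact ⟨apply_eq_of_isConnected hconn, fun h i j _ => h i j⟩

theorem kron_transpose_eq_zero_iff (hloop : ∀ i, ¬F.Adj i i) (hconn : IsConnected F)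
    (hZ : lap F = Z * Z.transpose) (x : Pow H n) :
    kron Z.transpose x = 0 ↔ ∀ i j, x i = x j := by
  simp only [kron_eq_zero_iff, transpose_mulVec_eq_zero_iff hloop hconn hZ]
  exact ⟨fun h i j => ext_inner_left ℝ fun y => h y i j, fun h y i j => by rw [h i j]⟩

theorem exists_mulVec_eq_of_sum_eq_zero (hloop : ∀ i, ¬F.Adj i i) (hconn : IsConnected F)
    (hZ : lap F = Z * Z.transpose) {b : Fin n → ℝ} (hb : ∑ i, b i = 0) : ∃ a, Z.mulVec a = b := by
  by_contra hrange
  obtain ⟨f, hfb, hf⟩ := Submodule.exists_le_ker_of_notMem (p := LinearMap.range Z.mulVecLin)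
    (by simpa using hrange)
  obtain ⟨c, rfl⟩ := (dotProductEquiv ℝ (Fin n)).surjective f
  have hcZ : Z.transpose.mulVec c = 0 := by
    rw [Matrix.mulVec_transpose]
    refine dotProduct_eq_zero _ fun a => ?_
    rw [← Matrix.dotProduct_mulVec]
    exact hf ⟨a, rfl⟩
  obtain ⟨i₀⟩ := hconn.nonempty
  have hconst := (transpose_mulVec_eq_zero_iff hloop hconn hZ c).1 hcZ
  refine hfb ?_
  simp only [dotProductEquiv_apply_apply, dotProduct, hconst _ i₀, ← Finset.mul_sum, hb, mul_zero]

theorem exists_kron_eq_iff (hloop : ∀ i, ¬F.Adj i i) (hconn : IsConnected F)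
    (hZ : lap F = Z * Z.transpose) {w : Pow H n} : (∃ v, kron Z v = w) ↔ ∑ i, w i = 0 := by
  constructor
  · rintro ⟨v, rfl⟩
    rw [sum_kron, (transpose_mulVec_eq_zero_iff hloop hconn hZ 1).2 fun _ _ => rfl]
    simp only [Pi.zero_apply, zero_smul, Finset.sum_const_zero]
  · intro hw
    -- A zero-sum `w` is `∑ j, (e j - e i₀) ⊗ w j`, where `e` is the standard basis of `ℝⁿ`.
    obtain ⟨i₀⟩ := hconn.nonempty
    choose N hN using fun j => exists_mulVec_eq_of_sum_eq_zero hloop hconn hZ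
      (b := Pi.single j 1 - Pi.single i₀ 1) (by simp)
    refine ⟨kron (Matrix.of N).transpose w, ?_⟩
    have hZN (i j) : (Z * (Matrix.of N).transpose) i j =
        (Pi.single j 1 - Pi.single i₀ 1 : Fin n → ℝ) i := congrFun (hN j) i
    ext i
    calc
      _ = ∑ j, (Z * (Matrix.of N).transpose) i j • w j := by rw [← kron_mul, kron_apply]
      _ = w i - (Pi.single i₀ 1 : Fin n → ℝ) i • ∑ j, w j := by
        simp [hZN, sub_smul, Finset.sum_sub_distrib, Finset.smul_sum, Pi.single_apply]
      _ = w i := by rw [hw, smul_zero, sub_zero]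

end GraphMatrices

/-! ### The single-valued part -/

section SingleValuedPart

variable {H : Type*} [NormedAddCommGroup H] [InnerProductSpace ℝ H]

theorem IsCocoercive.inner_add_nonneg {β : ℝ} (hβ : 0 < β) {B : H → H} (hB : IsCocoercive β B)
    (x y d : H) : 0 ≤ ⟪d, B x - B y⟫_ℝ + 1 / (4 * β) * ‖x - y - d‖ ^ 2 := by
  have hcoc := hB x y
  set b := B x - B y
  set e := x - y - d with he
  have hsplit : ⟪b, x - y⟫_ℝ = ⟪d, b⟫_ℝ + ⟪b, e⟫_ℝ := by
    rw [real_inner_comm b d, ← inner_add_right, he, add_sub_cancel]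
  have hyoung : 0 ≤ 1 / (4 * β) * ‖(2 * β) • b - e‖ ^ 2 := by positivity
  have hexpand : 1 / (4 * β) * ‖(2 * β) • b - e‖ ^ 2 =
      β * ‖b‖ ^ 2 - ⟪b, e⟫_ℝ + 1 / (4 * β) * ‖e‖ ^ 2 := by
    rw [norm_sub_sq_real, norm_smul, real_inner_smul_left, mul_pow, Real.norm_eq_abs, sq_abs]
    field
  linarith

theorem IsCocoercive.lipschitzWith {β : NNReal} (hβ : 0 < β) {B : H → H}
    (hB : IsCocoercive β B) : LipschitzWith β⁻¹ B := by
  refine LipschitzWith.of_dist_le_mul fun x y => ?_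
  rw [dist_eq_norm, dist_eq_norm, NNReal.coe_inv, ← div_eq_inv_mul,
    le_div_iff₀' (NNReal.coe_pos.2 hβ)]
  have hle := (hB x y).trans (real_inner_le_norm _ _)
  obtain h0 | h0 := (norm_nonneg (B x - B y)).eq_or_lt
  · simp [← h0]
  · refine le_of_mul_le_mul_left ?_ h0
    linarith

variable {n : ℕ} {G G' G'' : Digraph (Fin n)} {B : Fin (n - 1) → H → H}

theorem exists_lipschitzWith_opBD {β : ℝ} (hβ : 0 < β) (hB : ∀ i, IsCocoercive β (B i))
    (G'' : Digraph (Fin n)) : ∃ K, LipschitzWith K (opBD G'' B) := by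
  lift β to NNReal using hβ.le
  have hcoord (i : Fin n) : LipschitzWith β⁻¹ fun y : Fin n → H =>
      if h : i.val = 0 then 0 else B ⟨i.val - 1, by omega⟩ (y i) := by
    split_ifs with hi
    · exact (LipschitzWith.const 0).weaken zero_le
    · have heval : LipschitzWith 1 fun y : Fin n → H => y i := LipschitzWith.eval i
      simpa only [mul_one, Function.comp_def] using
        (IsCocoercive.lipschitzWith hβ (hB ⟨i.val - 1, by omega⟩)).comp heval
  obtain ⟨K, hK⟩ := exists_lipschitzWith_kron (H := H) (adj G'').transpose
  have hpi : LipschitzWith β⁻¹ fun (y : Fin n → H) i =>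
      if h : i.val = 0 then 0 else B ⟨i.val - 1, by omega⟩ (y i) :=
    fun y y' => edist_pi_le_iff.2 fun i => hcoord i y y'
  exact ⟨_, (PiLp.lipschitzWith_toLp 2 _).comp (hpi.comp ((PiLp.lipschitzWith_ofLp 2 _).comp hK))⟩

theorem opBD_apply_of_val_eq_zero {i : Fin n} (hi : i.val = 0) (x : Pow H n) :
    opBD G'' B x i = 0 :=
  dif_pos hi

theorem exists_adj_forall_opBD_apply {i : Fin n} (hi : i.val ≠ 0) (hin : inDeg G'' i = 1)
    (B : Fin (n - 1) → H → H) :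
    ∃ p, G''.Adj p i ∧ ∀ x : Pow H n, opBD G'' B x i = B ⟨i.val - 1, by omega⟩ (x p) := by
  obtain ⟨p, hp⟩ := Set.ncard_eq_one.1 hin
  have hadj (j) : G''.Adj j i ↔ j = p := by simpa using Set.ext_iff.1 hp j
  refine ⟨p, (hadj p).2 rfl, fun x => ?_⟩
  have hcol : kron (adj G'').transpose x i = x p := by simp [kron_apply, adj, hadj]
  rw [← hcol]
  exact dif_neg hi

theorem sum_opBD_const [NeZero n] (hin : ∀ i : Fin n, 1 ≤ i.val → inDeg G'' i = 1)
    (B : Fin (n - 1) → H → H) {x : Pow H n} {z : H} (hx : ∀ i, x i = z) :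
    ∑ i, opBD G'' B x i = ∑ i, B i z := by
  obtain ⟨m, rfl⟩ := Nat.exists_eq_succ_of_ne_zero (NeZero.ne n)
  rw [Fin.sum_univ_succ, opBD_apply_of_val_eq_zero rfl, zero_add]
  refine Finset.sum_congr rfl fun i _ => ?_
  obtain ⟨p, -, hp⟩ := exists_adj_forall_opBD_apply (by simp) (hin i.succ (by simp)) B
  rw [hp, hx]
  rfl

theorem inner_opBD_add_matP_nonneg {β : ℝ} (hβ : 0 < β) (hB : ∀ i, IsCocoercive β (B i))
    (hG'' : G'' ≤ G) (hin : ∀ i : Fin n, 1 ≤ i.val → inDeg G'' i = 1) (x y : Pow H n) :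
    0 ≤ ⟪x - y, opBD G'' B x - opBD G'' B y⟫_ℝ +
      1 / (4 * β) * ⟪x - y, kron (matP G) (x - y)⟫_ℝ := by
  set d := x - y with hd
  have hterm (i j) : 0 ≤ adj G j i * ‖d j - d i‖ ^ 2 := mul_nonneg (adj_nonneg G j i) (sq_nonneg _)
  rw [inner_kron_matP, Finset.sum_comm, PiLp.inner_apply, Finset.mul_sum,
    ← Finset.sum_add_distrib]
  refine Finset.sum_nonneg fun i _ => ?_
  by_cases hi : i.val = 0
  · rw [PiLp.sub_apply _ (opBD G'' B x), opBD_apply_of_val_eq_zero hi,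
      opBD_apply_of_val_eq_zero hi, sub_zero, inner_zero_right, zero_add]
    exact mul_nonneg (by positivity) (Finset.sum_nonneg fun j _ => hterm i j)
  -- The loss of cocoercivity at `i` is paid for by the edge along which `i` receives its input.
  · obtain ⟨p, hpi, hp⟩ := exists_adj_forall_opBD_apply hi (hin i (Nat.one_le_iff_ne_zero.2 hi)) B
    have hedge : ‖d p - d i‖ ^ 2 ≤ ∑ j, adj G j i * ‖d j - d i‖ ^ 2 := by
      simpa [adj_eq_one (hG'' hpi)] using
        Finset.single_le_sum (fun j _ => hterm i j) (Finset.mem_univ p)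
    calc
      0 ≤ _ := (hB _).inner_add_nonneg hβ (x p) (y p) (d i)
      _ = ⟪d i, (opBD G'' B x - opBD G'' B y) i⟫_ℝ + 1 / (4 * β) * ‖d p - d i‖ ^ 2 := by
        rw [PiLp.sub_apply _ (opBD G'' B x), hp, hp, hd, PiLp.sub_apply _ x y p]
      _ ≤ _ := by gcongr

/-- The single-valued part of the first row of the lifted operator, as an operator on `Hⁿ`: all
terms other than `τ • diag(A₁, …, Aₙ)` and `-(Z ⊗ Id)`. -/
def singleValuedPart (τ β : ℝ) (G G' G'' : Digraph (Fin n)) (B : Fin (n - 1) → H → H)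
    (x : Pow H n) : Pow H n :=
  kron (matP (G \ G')) x + kron (matQ G') x +
    (τ • opBD G'' B x + (τ / (4 * β)) • kron (matP G) x)

theorem inner_singleValuedPart_nonneg {τ β : ℝ} (hτ : 0 ≤ τ) (hβ : 0 < β)
    (hB : ∀ i, IsCocoercive β (B i)) (hG'' : G'' ≤ G)
    (hin : ∀ i : Fin n, 1 ≤ i.val → inDeg G'' i = 1) (G' : Digraph (Fin n)) (x y : Pow H n) :
    0 ≤ ⟪x - y, singleValuedPart τ β G G' G'' B x - singleValuedPart τ β G G' G'' B y⟫_ℝ := by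
  calc
    0 ≤ ⟪x - y, kron (matP (G \ G')) (x - y)⟫_ℝ + τ * _ :=
      add_nonneg (inner_kron_matP_nonneg _ _)
        (mul_nonneg hτ (inner_opBD_add_matP_nonneg hβ hB hG'' hin x y))
    _ = _ := by
      have hQ := inner_kron_matQ G' (x - y)
      simp only [singleValuedPart, kron_sub, inner_add_right, inner_sub_right, inner_smul_right]
        at hQ ⊢
      linear_combination -hQ

theorem exists_lipschitzWith_singleValuedPart (τ : ℝ) {β : ℝ} (hβ : 0 < β)
    (hB : ∀ i, IsCocoercive β (B i)) (G G' G'' : Digraph (Fin n)) :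
    ∃ K, LipschitzWith K (singleValuedPart τ β G G' G'' B) := by
  obtain ⟨_, hPG'⟩ := exists_lipschitzWith_kron (H := H) (matP (G \ G'))
  obtain ⟨_, hQ⟩ := exists_lipschitzWith_kron (H := H) (matQ G')
  obtain ⟨_, hPG⟩ := exists_lipschitzWith_kron (H := H) (matP G)
  obtain ⟨_, hBD⟩ := exists_lipschitzWith_opBD hβ hB G''
  exact ⟨_, (hPG'.add hQ).add (((lipschitzWith_smul τ).comp hBD).add
    ((lipschitzWith_smul (τ / (4 * β))).comp hPG))⟩

theorem sum_singleValuedPart_const [NeZero n] (τ β : ℝ) (G G' : Digraph (Fin n))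
    (hin : ∀ i : Fin n, 1 ≤ i.val → inDeg G'' i = 1) (B : Fin (n - 1) → H → H) {x : Pow H n}
    {z : H} (hx : ∀ i, x i = z) :
    ∑ i, singleValuedPart τ β G G' G'' B x i = τ • ∑ i, B i z := by
  simp only [singleValuedPart, PiLp.add_apply, PiLp.smul_apply, Finset.sum_add_distrib,
    ← Finset.smul_sum, sum_kron_const _ hx, sum_sum_matP, sum_sum_matQ,
    sum_opBD_const hin B hx, zero_smul, smul_zero, add_zero, zero_add]

end SingleValuedPart

/-! ### Zeros and maximal monotonicity of the lifted operator -/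

section LiftedOperator

variable {H : Type*} [NormedAddCommGroup H] [InnerProductSpace ℝ H] {n : ℕ}
  {G G' G'' : Digraph (Fin n)} {Z : Matrix (Fin n) (Fin (n - 1)) ℝ} {A : Fin n → H → Set H}
  {B : Fin (n - 1) → H → H} {τ β : ℝ}

theorem liftA_add_ofFun_liftB :
    liftA τ G G' Z A + ofFun (liftB τ β G G'' B) =
      saddle (τ • diagA A + ofFun (singleValuedPart τ β G G' G'' B)) (kron Z)
        (kron Z.transpose) := by
  ext u w
  have hrow (a : Pow H n) :
      w - liftB τ β G G'' B u = WithLp.toLp 2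
        (τ • a + kron (matP (G \ G')) u.fst + kron (matQ G') u.fst - kron Z u.snd,
          kron Z.transpose u.fst) ↔
      τ • a = w.fst + kron Z u.snd - singleValuedPart τ β G G' G'' B u.fst ∧
        w.snd = kron Z.transpose u.fst := by
    rw [← (WithLp.ofLp_injective 2).eq_iff, Prod.ext_iff]
    simp only [liftB, singleValuedPart, WithLp.ofLp_sub, Prod.fst_sub, Prod.snd_sub, sub_zero,
      WithLp.ofLp_fst, WithLp.ofLp_snd]
    refine and_congr ?_ Iff.rfl
    constructor <;> intro h <;> linear_combination (norm := module) -h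
  simp only [mem_add_ofFun, liftA, saddle, Set.mem_ofPred_eq, hrow, Pi.smul_apply,
    Set.mem_smul_set, ← and_assoc, exists_and_right]

theorem IsMaximallyMonotone.liftA_add_ofFun_liftB [CompleteSpace H]
    (hA : ∀ i, IsMaximallyMonotone (A i)) (hβ : 0 < β) (hB : ∀ i, IsCocoercive β (B i))
    (hG'' : G'' ≤ G) (hin : ∀ i : Fin n, 1 ≤ i.val → inDeg G'' i = 1) (hτ : 0 < τ)
    (G' : Digraph (Fin n)) (Z : Matrix (Fin n) (Fin (n - 1)) ℝ) :
    IsMaximallyMonotone (liftA τ G G' Z A + ofFun (liftB τ β G G'' B)) := by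
  obtain ⟨K, hK⟩ := exists_lipschitzWith_singleValuedPart τ hβ hB G G' G''
  rw [GraphFB.liftA_add_ofFun_liftB]
  exact (((isMaximallyMonotone_diagA hA).smul hτ).add_ofFun
    (inner_singleValuedPart_nonneg hτ.le hβ hB hG'' hin G') hK).saddle
    fun x v => (inner_kron_transpose Z x v).symm

theorem exists_kron_mem_iff_mem_zer_sum (hloop : ∀ i, ¬G'.Adj i i) (hconn : IsConnected G')
    (hin : ∀ i : Fin n, 1 ≤ i.val → inDeg G'' i = 1) (hZ : lap G' = Z * Z.transpose) (hτ : τ ≠ 0)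
    {x : Pow H n} {z : H} (hx : ∀ i, x i = z) :
    (∃ v, kron Z v ∈ (τ • diagA A + ofFun (singleValuedPart τ β G G' G'' B)) x) ↔
      z ∈ zer (∑ i, A i + ∑ i, ofFun (B i)) := by
  have : NeZero n := ⟨by rintro rfl; exact hconn.nonempty.elim finZeroElim⟩
  have hsum (a : Pow H n) :
      (∃ v, τ • a + singleValuedPart τ β G G' G'' B x = kron Z v) ↔
        ∑ i, a i + ∑ i, B i z = 0 := by
    simp only [eq_comm (b := kron Z _), exists_kron_eq_iff hloop hconn hZ, PiLp.add_apply,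
      PiLp.smul_apply, Finset.sum_add_distrib, ← Finset.smul_sum,
      sum_singleValuedPart_const _ _ _ _ hin B hx, ← smul_add, smul_eq_zero_iff_right hτ]
  calc
    _ ↔ ∃ a ∈ diagA A x, ∃ v, τ • a + singleValuedPart τ β G G' G'' B x = kron Z v := by
      simp only [mem_add_ofFun, Pi.smul_apply, Set.mem_smul_set, eq_sub_iff_add_eq,
        ← exists_and_left]
      exact exists_comm
    _ ↔ ∃ a : Fin n → H, (∀ i, a i ∈ A i z) ∧ ∑ i, a i + ∑ i, B i z = 0 := by
      simp only [hsum, diagA, hx]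
      exact (WithLp.equiv 2 _).exists_congr fun _ => Iff.rfl
    _ ↔ _ := mem_zer_sum_add_sum_ofFun.symm

theorem exists_mem_zer_liftA_add_ofFun_liftB_iff (hloop : ∀ i, ¬G'.Adj i i)
    (hconn : IsConnected G') (hin : ∀ i : Fin n, 1 ≤ i.val → inDeg G'' i = 1)
    (hZ : lap G' = Z * Z.transpose) (hτ : τ ≠ 0) (x : Pow H n) :
    (∃ v : Pow H (n - 1), (WithLp.toLp 2 (x, v) : Lifted H n) ∈
        zer (liftA τ G G' Z A + ofFun (liftB τ β G G'' B))) ↔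
      ∃ z : H, (∀ i, x i = z) ∧ z ∈ zer (∑ i, A i + ∑ i, ofFun (B i)) := by
  have hconsensus : (∀ i j, x i = x j) ↔ ∃ z, ∀ i, x i = z := by
    obtain ⟨i₀⟩ := hconn.nonempty
    exact ⟨fun h => ⟨x i₀, fun i => h i i₀⟩, fun ⟨z, hz⟩ i j => (hz i).trans (hz j).symm⟩
  have hiff {z : H} (hz : ∀ i, x i = z) :=
    exists_kron_mem_iff_mem_zer_sum (A := A) (B := B) (G := G) (β := β) hloop hconn hin hZ hτ hz
  rw [liftA_add_ofFun_liftB]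
  simp only [zer, Set.mem_ofPred_eq, zero_mem_saddle_iff,
    kron_transpose_eq_zero_iff hloop hconn hZ, hconsensus] at hiff ⊢
  exact ⟨fun ⟨v, hv, z, hz⟩ => ⟨z, hz, (hiff hz).1 ⟨v, hv⟩⟩,
    fun ⟨z, hz, hz₀⟩ => ((hiff hz).2 hz₀).imp fun v hv => ⟨hv, z, hz⟩⟩

end LiftedOperator

end GraphFB

end

theorem theorem3p1_general {H : Type*} [NormedAddCommGroup H] [InnerProductSpace ℝ H]
    [CompleteSpace H] (n : ℕ)
    (A : Fin n → H → Set H) (hA : ∀ i, GraphFB.IsMaximallyMonotone (A i))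
    (β : ℝ) (hβ : 0 < β)
    (B : Fin (n - 1) → H → H) (hB : ∀ i, GraphFB.IsCocoercive β (B i))
    (G G' G'' : Digraph (Fin n))
    (hloop : ∀ i, ¬G'.Adj i i) (hG'conn : GraphFB.IsConnected G')
    (hG'' : G'' ≤ G) (hG''in : ∀ i : Fin n, 1 ≤ i.val → GraphFB.inDeg G'' i = 1)
    (Z : Matrix (Fin n) (Fin (n - 1)) ℝ) (hZ : GraphFB.lap G' = Z * Z.transpose)
    (τ : ℝ) (hτ : 0 < τ) :
    (∀ x : GraphFB.Pow H n,
      (∃ v : GraphFB.Pow H (n - 1),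
        (WithLp.toLp 2 (x, v) : GraphFB.Lifted H n) ∈
          GraphFB.zer
            (GraphFB.liftA τ G G' Z A + GraphFB.ofFun (GraphFB.liftB τ β G G'' B))) ↔
      ∃ z : H, (∀ i, x i = z) ∧ z ∈ GraphFB.zer (∑ i, A i + ∑ i, GraphFB.ofFun (B i))) ∧
    GraphFB.IsMaximallyMonotone
      (GraphFB.liftA τ G G' Z A + GraphFB.ofFun (GraphFB.liftB τ β G G'' B)) :=
  ⟨GraphFB.exists_mem_zer_liftA_add_ofFun_liftB_iff hloop hG'conn hG''in hZ hτ.ne',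
    GraphFB.IsMaximallyMonotone.liftA_add_ofFun_liftB hA hβ hB hG'' hG''in hτ G' Z⟩

theorem theorem3p1 {H : Type*} [NormedAddCommGroup H] [InnerProductSpace ℝ H] [CompleteSpace H]
    (n : ℕ) (hn : 2 ≤ n)
    (A : Fin n → H → Set H) (hA : ∀ i, GraphFB.IsMaximallyMonotone (A i))
    (β : ℝ) (hβ : 0 < β)
    (B : Fin (n - 1) → H → H) (hB : ∀ i, GraphFB.IsCocoercive β (B i))
    (hzer : (GraphFB.zer (∑ i, A i + ∑ i, GraphFB.ofFun (B i))).Nonempty)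
    (G G' G'' : Digraph (Fin n))
    (hG : GraphFB.IsAlgorithmic G)
    (hG' : G' ≤ G) (hG'conn : GraphFB.IsConnected G')
    (hG'' : G'' ≤ G) (hG''in : ∀ i : Fin n, 1 ≤ i.val → GraphFB.inDeg G'' i = 1)
    (Z : Matrix (Fin n) (Fin (n - 1)) ℝ) (hZ : GraphFB.lap G' = Z * Z.transpose)
    (τ : ℝ) (hτ : 0 < τ) :
    (∀ x : GraphFB.Pow H n,
      (∃ v : GraphFB.Pow H (n - 1),
        (WithLp.toLp 2 (x, v) : GraphFB.Lifted H n) ∈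
          GraphFB.zer
            (GraphFB.liftA τ G G' Z A + GraphFB.ofFun (GraphFB.liftB τ β G G'' B))) ↔
      ∃ z : H, (∀ i, x i = z) ∧ z ∈ GraphFB.zer (∑ i, A i + ∑ i, GraphFB.ofFun (B i))) ∧
    GraphFB.IsMaximallyMonotone
      (GraphFB.liftA τ G G' Z A + GraphFB.ofFun (GraphFB.liftB τ β G G'' B)) :=
  theorem3p1_general n A hA β hβ B hB G G' G'' (fun i hi => (hG.2.1 i i (hG' hi)).false)
    hG'conn hG'' hG''in Z hZ τ hτ
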